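/- Let $q$ be a prime power, $n\ge 1$, let $K=\mathbb{F}_{q^n}$, and let $\sigma$ be an automorphism of $K$ with fixed field $\mathbb{F}_q$. Let $R=K[t;\sigma]$ be the skew polynomial ring, with multiplication determined by $ta=a^{\sigma}t$ for $a\in K$. Write $h\equiv 0 \bmod f$ if $f$ divides $h$ on the right, that is, $h=af$ for some $a\in R$. An element of $R$ is irreducible if it is nonzero, is not a unit, and is not a product of two non-units; equivalently, it has positive degree and is not a product of two elements of smaller degree. For an irreducible $f\in R$, the minimal central left multiple $\mathrm{mzlm}(f)$ is the (unique) monic polynomial of minimal degree among the elements of the centre of $R$ that are right-divisible by $f$. Two irreducibles $f,g\in R$ are called similar if they have the same degree $d$ and there is a nonzero $u\in R$ with $\deg u<d$ and $gu\equiv 0 \bmod f$. Let $f$ and $g$ be irreducible in $R$. Then $f$ and $g$ are similar if and only if $\mathrm{mzlm}(f)=\mathrm{mzlm}(g)$. -/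

import Mathlib

namespace SkewPolynomial

section Degree

variable {K : Type*} [Semiring K]

/-- The degree of a skew polynomial, with `degree 0 = ⊥`. -/
def degree (f : SkewPolynomial K) : WithBot ℕ := f.support.max

/-- The degree as a natural number, with `natDegree 0 = 0`. -/
def natDegree (f : SkewPolynomial K) : ℕ := f.degree.unbotD 0

/-- The leading coefficient is `1`. -/
def Monic (f : SkewPolynomial K) : Prop := f.coeff f.natDegree = 1

end Degree

section Notions

variable {K : Type*} [Field K] [MulSemiringAction (Multiplicative ℕ) K]

/-- `f` divides `h` on the right: `h = a f` for some `a`, i.e. `h ≡ 0 mod f`, where the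
remainder is the one of right division by `f`. -/
def RightDvd (f h : SkewPolynomial K) : Prop := ∃ a : SkewPolynomial K, h = a * f

/-- `f` and `g` are similar: they have the same degree `d`, and `g u ≡ 0 mod f` for some nonzero
`u` of degree less than `d`. -/
def Similar (f g : SkewPolynomial K) : Prop :=
  f.degree = g.degree ∧
    ∃ u : SkewPolynomial K, u ≠ 0 ∧ u.degree < f.degree ∧ RightDvd f (g * u)

/-- `m` is a monic central left multiple of `f`. -/
def IsMonicCentralLeftMultiple (f m : SkewPolynomial K) : Prop :=
  m.Monic ∧ m ∈ Subring.center (SkewPolynomial K) ∧ RightDvd f m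

/-- `m` is a monic polynomial of minimal degree among the central elements that are right
divisible by `f`. -/
def IsMzlm (f m : SkewPolynomial K) : Prop :=
  IsMonicCentralLeftMultiple f m ∧
    ∀ m' : SkewPolynomial K, IsMonicCentralLeftMultiple f m' → m.degree ≤ m'.degree

open Classical in
/-- The minimal central left multiple of `f`. For a nonzero `f` over a finite field it exists and
is unique, see `isMzlm_mzlm` and `IsMzlm.unique` below; the value `0` is used only where there is
none. -/
noncomputable def mzlm (f : SkewPolynomial K) : SkewPolynomial K :=
  if h : ∃ m, IsMzlm f m then h.choose else 0

end Notions

section WellDefined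

variable {K : Type*} [Field K]

theorem degree_eq_natDegree {f : SkewPolynomial K} (hf : f ≠ 0) :
    f.degree = (f.natDegree : WithBot ℕ) := by
  have h : f.degree ≠ ⊥ := by
    intro h
    exact hf (support_eq_empty.1 (Finset.max_eq_bot.1 h))
  obtain ⟨n, hn⟩ := WithBot.ne_bot_iff_exists.1 h
  rw [natDegree, ← hn]
  rfl

theorem coeff_natDegree_ne_zero {f : SkewPolynomial K} (hf : f ≠ 0) :
    f.coeff f.natDegree ≠ 0 :=
  mem_support_iff.1 (Finset.mem_of_max (degree_eq_natDegree hf))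

theorem coeff_eq_zero_of_degree_lt {f : SkewPolynomial K} {n : ℕ}
    (h : f.degree < (n : WithBot ℕ)) : f.coeff n = 0 := by
  by_contra hn
  exact absurd (Finset.le_max (mem_support_iff.2 hn)) (not_le.2 h)

theorem coeff_eq_zero_of_natDegree_lt {f : SkewPolynomial K} {n : ℕ}
    (h : f.natDegree < n) : f.coeff n = 0 := by
  by_cases hf : f = 0
  · simp [hf]
  · exact coeff_eq_zero_of_degree_lt (by rw [degree_eq_natDegree hf]; exact_mod_cast h)

theorem degree_lt_of_coeff {f : SkewPolynomial K} {N : ℕ}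
    (h : ∀ n, N ≤ n → f.coeff n = 0) : f.degree < (N : WithBot ℕ) := by
  by_cases hf : f = 0
  · subst hf
    simp only [degree, support_zero, Finset.max_empty]
    exact WithBot.bot_lt_coe N
  · rw [degree_eq_natDegree hf]
    have := coeff_natDegree_ne_zero hf
    by_contra hN
    exact this (h _ (by exact_mod_cast not_lt.1 hN))

theorem natDegree_eq_of_coeff {f : SkewPolynomial K} {N : ℕ} (h0 : f.coeff N ≠ 0)
    (h : ∀ n, N < n → f.coeff n = 0) : f.natDegree = N := by
  have hf : f ≠ 0 := by
    rintro rfl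
    simp at h0
  rcases lt_trichotomy f.natDegree N with h1 | h1 | h1
  · exact absurd (coeff_eq_zero_of_natDegree_lt h1) h0
  · exact h1
  · exact absurd (h _ h1) (coeff_natDegree_ne_zero hf)

variable [MulSemiringAction (Multiplicative ℕ) K]

theorem coeff_monomial_mul_add (k n : ℕ) (a : K) (f : SkewPolynomial K) :
    (monomial k a * f).coeff (n + k) = a * φ^[k] (f.coeff n) := by
  rw [φ_iterate_apply]
  refine SkewMonoidAlgebra.coeff_single_mul_aux f (fun b => ?_)
  rw [← Multiplicative.toAdd.injective.eq_iff, ← Multiplicative.toAdd.injective.eq_iff]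
  simp only [toAdd_mul, toAdd_ofAdd]
  omega

theorem coeff_mul_monomial_add (k n : ℕ) (a : K) (f : SkewPolynomial K) :
    (f * monomial k a).coeff (n + k) = f.coeff n * φ^[n] a := by
  rw [φ_iterate_apply]
  refine SkewMonoidAlgebra.coeff_mul_single_aux f (fun b => ?_)
  rw [← Multiplicative.toAdd.injective.eq_iff, ← Multiplicative.toAdd.injective.eq_iff]
  simp only [toAdd_mul, toAdd_ofAdd]
  omega

theorem coeff_C_mul' (n : ℕ) (a : K) (f : SkewPolynomial K) :
    (C a * f).coeff n = a * f.coeff n := by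
  simpa using coeff_monomial_mul_add 0 n a f

theorem φ_iterate_eq_zero_iff (k : ℕ) (a : K) : (φ^[k] a) = 0 ↔ a = 0 := by
  rw [← RingHom.coe_pow]
  exact map_eq_zero _

/-- Right division with remainder. -/
theorem exists_right_division {f : SkewPolynomial K} (hf : f ≠ 0) (p : SkewPolynomial K) :
    ∃ a r : SkewPolynomial K, p = a * f + r ∧ r.degree < f.degree := by
  suffices H : ∀ (N : ℕ) (p : SkewPolynomial K), (∀ n, N ≤ n → p.coeff n = 0) →
      ∃ a r : SkewPolynomial K, p = a * f + r ∧ r.degree < f.degree from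
    H (p.natDegree + 1) p (fun n hn => coeff_eq_zero_of_natDegree_lt hn)
  intro N
  induction N with
  | zero =>
    intro p hp
    refine ⟨0, p, by simp, ?_⟩
    rw [degree_eq_natDegree hf]
    exact degree_lt_of_coeff fun n _ => hp n n.zero_le
  | succ N ih =>
    intro p hp
    by_cases hN : N < f.natDegree
    · refine ⟨0, p, by simp, ?_⟩
      rw [degree_eq_natDegree hf]
      exact degree_lt_of_coeff fun n hn => hp n (by omega)
    · push Not at hN
      obtain ⟨k, rfl⟩ := Nat.exists_eq_add_of_le hN
      set b := φ^[k] (f.coeff f.natDegree) with hb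
      have hb0 : b ≠ 0 := fun h =>
        coeff_natDegree_ne_zero hf ((φ_iterate_eq_zero_iff k _).1 h)
      set c := p.coeff (f.natDegree + k) * b⁻¹ with hc
      obtain ⟨a, r, h, hr⟩ := ih (p - monomial k c * f) (fun n hn => by
        obtain ⟨j, rfl⟩ : ∃ j, n = j + k := ⟨n - k, by omega⟩
        rw [coeff_sub, coeff_monomial_mul_add]
        rcases eq_or_lt_of_le (show f.natDegree ≤ j by omega) with h | h
        · subst h
          rw [← hb, hc, mul_assoc, inv_mul_cancel₀ hb0, mul_one, sub_self]
        · rw [hp _ (by omega), coeff_eq_zero_of_natDegree_lt h]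
          simp)
      refine ⟨monomial k c + a, r, ?_, hr⟩
      rw [add_mul, add_assoc, ← h]
      abel

theorem mem_center_of_commute {z : SkewPolynomial K}
    (h : ∀ (n : ℕ) (a : K), monomial n a * z = z * monomial n a) :
    z ∈ Subring.center (SkewPolynomial K) := by
  rw [Subring.mem_center_iff]
  intro p
  induction p using SkewPolynomial.induction with
  | h0 => simp
  | ha n r q _ _ hq => rw [add_mul, mul_add, h, hq]

theorem C_mem_center {c : K} (hc : (φ c : K) = c) :
    C c ∈ Subring.center (SkewPolynomial K) := by
  refine mem_center_of_commute fun n a => ?_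
  rw [monomial_mul_C, C_mul_monomial, Function.iterate_fixed hc, mul_comm]

theorem IsMzlm.unique {f m m' : SkewPolynomial K} (h : IsMzlm f m) (h' : IsMzlm f m') :
    m = m' := by
  by_contra hne
  have hm : m ≠ 0 := by
    rintro rfl
    simpa [Monic] using h.1.1
  have hm' : m' ≠ 0 := by
    rintro rfl
    simpa [Monic] using h'.1.1
  have hdeg : m.natDegree = m'.natDegree := by
    have := le_antisymm (h.2 m' h'.1) (h'.2 m h.1)
    rw [degree_eq_natDegree hm, degree_eq_natDegree hm'] at this
    exact_mod_cast this
  set e := m - m' with he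
  have he0 : e ≠ 0 := sub_ne_zero.2 hne
  have hlt : e.natDegree < m.natDegree := by
    have : e.degree < (m.natDegree : WithBot ℕ) := degree_lt_of_coeff fun n hn => by
      rw [he, coeff_sub]
      rcases eq_or_lt_of_le hn with h1 | h1
      · have h2 : m.coeff m.natDegree = 1 := h.1.1
        have h3 : m'.coeff m'.natDegree = 1 := h'.1.1
        rw [← h1, h2, hdeg, h3, sub_self]
      · rw [coeff_eq_zero_of_natDegree_lt h1, coeff_eq_zero_of_natDegree_lt (hdeg ▸ h1), sub_self]
    rw [degree_eq_natDegree he0] at this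
    exact_mod_cast this
  have hec : e ∈ Subring.center (SkewPolynomial K) := Subring.sub_mem _ h.1.2.1 h'.1.2.1
  set c := e.coeff e.natDegree with hc
  have hc0 : c ≠ 0 := coeff_natDegree_ne_zero he0
  have hφ : (φ c : K) = c := by
    have h1 := congrArg (fun p => coeff p (e.natDegree + 1))
      (Subring.mem_center_iff.1 hec (monomial 1 1))
    simp only [coeff_monomial_mul_add, coeff_mul_monomial_add] at h1
    simpa using h1
  have hφ' : (φ c⁻¹ : K) = c⁻¹ := by rw [map_inv₀, hφ]
  have hcoeff : ∀ n, (C c⁻¹ * e).coeff n = c⁻¹ * e.coeff n := fun n => coeff_C_mul' n _ _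
  have hnat : (C c⁻¹ * e).natDegree = e.natDegree := by
    refine natDegree_eq_of_coeff ?_ fun n hn => ?_
    · rw [hcoeff, ← hc, inv_mul_cancel₀ hc0]
      exact one_ne_zero
    · rw [hcoeff, coeff_eq_zero_of_natDegree_lt hn, mul_zero]
  have hmul : IsMonicCentralLeftMultiple f (C c⁻¹ * e) := by
    refine ⟨?_, Subring.mul_mem _ (C_mem_center hφ') hec, ?_⟩
    · rw [Monic, hnat, hcoeff, ← hc, inv_mul_cancel₀ hc0]
    · obtain ⟨a, ha⟩ := h.1.2.2
      obtain ⟨a', ha'⟩ := h'.1.2.2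
      exact ⟨C c⁻¹ * (a - a'), by rw [mul_assoc, sub_mul, ← ha, ← ha']⟩
  have hce0 : C c⁻¹ * e ≠ 0 := by
    intro h0
    have := hmul.1
    rw [h0] at this
    simp [Monic] at this
  have := h.2 _ hmul
  rw [degree_eq_natDegree hm, degree_eq_natDegree hce0, hnat] at this
  exact absurd (by exact_mod_cast this) (not_le.2 hlt)

theorem exists_φ_iterate_eq_id [Finite K] : ∃ n : ℕ, 0 < n ∧ ∀ a : K, (φ^[n] a) = a := by
  have hbij : Function.Bijective (φ : K →+* K) :=
    Finite.injective_iff_bijective.1 (φ : K →+* K).injective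
  let s : Equiv.Perm K := Equiv.ofBijective _ hbij
  refine ⟨orderOf s, orderOf_pos s, fun a => ?_⟩
  have h1 : (s ^ orderOf s) a = a := by rw [pow_orderOf_eq_one]; rfl
  rw [← Equiv.Perm.iterate_eq_pow] at h1
  exact h1

theorem exists_isMonicCentralLeftMultiple [Finite K] {f : SkewPolynomial K} (hf : f ≠ 0) :
    ∃ m, IsMonicCentralLeftMultiple f m := by
  obtain ⟨n, hn, hφ⟩ := exists_φ_iterate_eq_id (K := K)
  have hφ' : ∀ (k : ℕ) (a : K), (φ^[n * k] a) = a := fun k a => by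
    rw [Function.iterate_mul]
    exact Function.iterate_fixed (hφ a) k
  have hcen : ∀ k : ℕ, (monomial (n * k) (1 : K)) ∈ Subring.center (SkewPolynomial K) :=
    fun k => mem_center_of_commute fun j a => by
      rw [monomial_mul_monomial, monomial_mul_monomial, hφ', iterate_map_one, mul_one, one_mul,
        add_comm]
  choose a r har hr using fun k : ℕ => exists_right_division hf (monomial (n * k) (1 : K))
  obtain ⟨i, j, hij, hrr⟩ := Finite.exists_ne_map_eq_of_infinite
    (fun k : ℕ => fun l : Fin f.natDegree => (r k).coeff l)
  wlog hlt : i < j generalizing i j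
  · exact this j i hij.symm hrr.symm (lt_of_le_of_ne (not_lt.1 hlt) hij.symm)
  have hreq : r i = r j := by
    ext l
    by_cases hl : l < f.natDegree
    · exact congrFun hrr ⟨l, hl⟩
    · have h0 : ∀ k, (r k).coeff l = 0 := fun k => by
        refine coeff_eq_zero_of_degree_lt ((hr k).trans_le ?_)
        rw [degree_eq_natDegree hf]
        exact_mod_cast not_lt.1 hl
      rw [h0, h0]
  have hlt' : n * i < n * j := Nat.mul_lt_mul_of_pos_left hlt hn
  refine ⟨monomial (n * j) 1 - monomial (n * i) 1, ?_, Subring.sub_mem _ (hcen j) (hcen i),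
    a j - a i, ?_⟩
  · have hco : (monomial (n * j) (1 : K) - monomial (n * i) 1).coeff (n * j) = 1 := by
      rw [coeff_sub, coeff_monomial, coeff_monomial, if_pos rfl, if_neg hlt'.ne, sub_zero]
    have hnd : (monomial (n * j) (1 : K) - monomial (n * i) 1).natDegree = n * j := by
      refine natDegree_eq_of_coeff (by rw [hco]; exact one_ne_zero) fun l hl => ?_
      rw [coeff_sub, coeff_monomial, coeff_monomial, if_neg hl.ne, if_neg (hlt'.trans hl).ne,
        sub_zero]
    rw [Monic, hnd, hco]
  · rw [har j, har i, hreq, sub_mul]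
    abel

/-- Over a finite field, the minimal central left multiple of a nonzero element exists. -/
theorem isMzlm_mzlm [Finite K] {f : SkewPolynomial K} (hf : f ≠ 0) : IsMzlm f (mzlm f) := by
  have hex : ∃ m, IsMzlm f m := by
    have hne : {m | IsMonicCentralLeftMultiple f m}.Nonempty :=
      exists_isMonicCentralLeftMultiple hf
    obtain ⟨m, hm, hmin⟩ := (InvImage.wf (fun p : SkewPolynomial K => p.degree)
      wellFounded_lt).has_min _ hne
    exact ⟨m, hm, fun m' hm' => not_lt.1 (hmin m' hm')⟩
  rw [mzlm, dif_pos hex]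
  exact hex.choose_spec

end WellDefined

end SkewPolynomial

/-! Write `R` for the skew polynomial ring. Division makes every left ideal principal, so for
irreducible `f` the left module `R/Rf` is simple, and `K` finite makes it finite. A `u` outside `Rf`
with `g u ∈ Rf` gives, by right multiplication, a nonzero map `R/Rg → R/Rf`, hence an isomorphism. A
central element lies in `Rf` exactly when it kills `R/Rf`, so similar elements have the same central
left multiples (`rightDvd_iff_of_mem_center`).

For the converse, suppose first that `f` does not divide `X`. The annihilator of `R/Rf` is a
two-sided ideal whose monic element of least degree turns out to be central, so it is `R · mzlm f`
(`quotientAnnihilator_eq_span_mzlm`). If `mzlm f = mzlm g`, this annihilator lies in `Rg`. Were `g`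
injective on the finite module `R/Rf`, some positive power of `g` would act as `1`; then `g` would
divide `g ^ (k + 1) - 1`, hence `1`. So `g` kills a nonzero class `u` (`exists_rightDvd_mul`).
Exchanging `f` and `g` and counting remainders gives equal degrees.

If `f` divides `X`, then `f` is a unit times `X`, and the annihilator `RX` need not have a central
generator. This case is recognised by the vanishing constant coefficient of `mzlm f`; then `g` is a
unit times `X` too, and `u = 1` works. -/

namespace SkewPolynomial

/-! ### Degrees of products -/

section Degree

variable {K : Type*} [Field K]

theorem Monic.ne_zero {m : SkewPolynomial K} (hm : m.Monic) : m ≠ 0 := by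
  rintro rfl
  simp [Monic] at hm

theorem degree_lt_iff_coeff {f : SkewPolynomial K} {N : ℕ} :
    f.degree < (N : WithBot ℕ) ↔ ∀ n, N ≤ n → f.coeff n = 0 :=
  ⟨fun h _ hn => coeff_eq_zero_of_degree_lt (h.trans_le (by exact_mod_cast hn)),
    degree_lt_of_coeff⟩

theorem coeff_sum {ι : Type*} (s : Finset ι) (p : ι → SkewPolynomial K) (n : ℕ) :
    (∑ i ∈ s, p i).coeff n = ∑ i ∈ s, (p i).coeff n := by
  classical
  induction s using Finset.induction_on with
  | empty => simp
  | insert i s hi ih => rw [Finset.sum_insert hi, Finset.sum_insert hi, coeff_add, ih]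

/-- The polynomials of degree less than `N` are given by their first `N` coefficients. -/
noncomputable def degreeLTEquiv (N : ℕ) :
    {f : SkewPolynomial K // f.degree < (N : WithBot ℕ)} ≃ (Fin N → K) where
  toFun f i := f.1.coeff i
  invFun v := ⟨∑ i : Fin N, monomial (i : ℕ) (v i), by
    refine degree_lt_of_coeff fun n hn => ?_
    rw [coeff_sum]
    refine Finset.sum_eq_zero fun i _ => ?_
    rw [coeff_monomial, if_neg (by have := i.2; omega)]⟩
  left_inv f := by
    ext n
    simp only [coeff_sum, coeff_monomial]
    by_cases hn : n < N
    · rw [Finset.sum_eq_single ⟨n, hn⟩]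
      · simp
      · intro b _ hb
        exact if_neg fun h => hb (Fin.ext h)
      · simp
    · rw [degree_lt_iff_coeff.1 f.2 n (not_lt.1 hn)]
      refine Finset.sum_eq_zero fun i _ => if_neg (by have := i.2; omega)
  right_inv v := by
    ext j
    simp only [coeff_sum, coeff_monomial]
    rw [Finset.sum_eq_single j]
    · simp
    · intro b _ hb
      exact if_neg fun h => hb (Fin.ext h)
    · simp

variable [MulSemiringAction (Multiplicative ℕ) K]

/-- Induction on `p`, splitting off the term of `a` in degree `p + 1`. Bounds are used instead of
exact degrees because what remains after the erasure may have any smaller degree. -/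
theorem coeff_mul_of_natDegree_le {q : ℕ} {f : SkewPolynomial K}
    (hf : ∀ n, q < n → f.coeff n = 0) (p : ℕ) (a : SkewPolynomial K)
    (ha : ∀ n, p < n → a.coeff n = 0) :
    (a * f).coeff (q + p) = a.coeff p * φ^[p] (f.coeff q) ∧
      ∀ n, q + p < n → (a * f).coeff n = 0 := by
  induction p generalizing a with
  | zero =>
    have h : a = C (a.coeff 0) := by
      ext n
      cases n with
      | zero => simp
      | succ n => rw [ha _ n.succ_pos, coeff_C_succ]
    rw [h]
    refine ⟨by simp [coeff_C_mul'], fun n hn => ?_⟩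
    rw [coeff_C_mul', hf n (by omega), mul_zero]
  | succ p ih =>
    obtain ⟨-, h⟩ := ih (a.erase (p + 1)) fun n hn => by
      rcases eq_or_ne n (p + 1) with rfl | h
      · rw [coeff_erase, if_pos rfl]
      · rw [coeff_erase, if_neg h, ha n (by omega)]
    have key : ∀ n, q + p < n →
        (a * f).coeff n = (monomial (p + 1) (a.coeff (p + 1)) * f).coeff n := fun n hn => by
      conv_lhs => rw [← monomial_add_erase a (p + 1), add_mul, coeff_add, h n hn, add_zero]
    refine ⟨by rw [key _ (by omega), coeff_monomial_mul_add], fun n hn => ?_⟩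
    obtain ⟨j, rfl⟩ : ∃ j, n = j + (p + 1) := ⟨n - (p + 1), by omega⟩
    rw [key _ (by omega), coeff_monomial_mul_add, hf j (by omega), iterate_map_zero, mul_zero]

theorem natDegree_mul {a f : SkewPolynomial K} (ha : a ≠ 0) (hf : f ≠ 0) :
    a * f ≠ 0 ∧ (a * f).natDegree = f.natDegree + a.natDegree := by
  obtain ⟨h1, h2⟩ := coeff_mul_of_natDegree_le (f := f)
    (fun n hn => coeff_eq_zero_of_natDegree_lt hn) a.natDegree a
    (fun n hn => coeff_eq_zero_of_natDegree_lt hn)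
  have h : (a * f).coeff (f.natDegree + a.natDegree) ≠ 0 := by
    rw [h1]
    exact mul_ne_zero (coeff_natDegree_ne_zero ha)
      (mt (φ_iterate_eq_zero_iff _ _).1 (coeff_natDegree_ne_zero hf))
  exact ⟨fun h0 => h (by rw [h0, coeff_zero]), natDegree_eq_of_coeff h h2⟩

theorem eq_zero_of_rightDvd_of_degree_lt {f u : SkewPolynomial K} (h : RightDvd f u)
    (hu : u.degree < f.degree) : u = 0 := by
  obtain ⟨a, rfl⟩ := h
  by_contra h0
  have ha : a ≠ 0 := left_ne_zero_of_mul h0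
  have hf : f ≠ 0 := right_ne_zero_of_mul h0
  rw [degree_eq_natDegree h0, degree_eq_natDegree hf, (natDegree_mul ha hf).2] at hu
  have : f.natDegree + a.natDegree < f.natDegree := by exact_mod_cast hu
  omega

theorem isUnit_C {c : K} (hc : c ≠ 0) : IsUnit (C c : SkewPolynomial K) :=
  (IsUnit.mk0 c hc).map (CRingHom (R := K))

end Degree

/-! ### Left ideals, simple quotients, and invariance of central multiples -/

section Ideals

variable {K : Type*} [Field K] [MulSemiringAction (Multiplicative ℕ) K]

theorem rightDvd_iff_mem_span {f h : SkewPolynomial K} :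
    RightDvd f h ↔ h ∈ Ideal.span ({f} : Set (SkewPolynomial K)) := by
  simp only [RightDvd, Ideal.mem_span_singleton', eq_comm]

/-- Every left ideal is principal: it is generated by an element of minimal degree. -/
theorem exists_eq_span_singleton (I : Ideal (SkewPolynomial K)) : ∃ h, I = Ideal.span {h} := by
  by_cases hI : ∃ x ∈ I, x ≠ 0
  · obtain ⟨h, ⟨hI, h0⟩, hmin⟩ := (InvImage.wf (fun p : SkewPolynomial K => p.degree)
      wellFounded_lt).has_min {x | x ∈ I ∧ x ≠ 0} hI
    refine ⟨h, le_antisymm (fun x hx => ?_) ((Ideal.span_singleton_le_iff_mem I).2 hI)⟩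
    obtain ⟨a, r, rfl, hr⟩ := exists_right_division h0 x
    have hrI : r ∈ I := (Submodule.add_mem_iff_right I (I.mul_mem_left a hI)).1 hx
    have : r = 0 := by
      by_contra hr0
      exact hmin r ⟨hrI, hr0⟩ hr
    rw [this, add_zero]
    exact Ideal.mem_span_singleton'.2 ⟨a, rfl⟩
  · push Not at hI
    exact ⟨0, le_antisymm (fun x hx => by simp [hI x hx]) (by simp)⟩

theorem span_singleton_isMaximal {f : SkewPolynomial K} (hf : Irreducible f) :
    (Ideal.span ({f} : Set (SkewPolynomial K))).IsMaximal := by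
  have key : ∀ a h : SkewPolynomial K, a * h = f → ¬ IsUnit h → h ∈ Ideal.span {f} := by
    intro a h hah hh
    obtain ⟨b, rfl⟩ := (hf.isUnit_or_isUnit hah.symm).resolve_right hh
    exact Ideal.mem_span_singleton'.2 ⟨↑b⁻¹, by rw [← hah, ← mul_assoc, b.inv_mul, one_mul]⟩
  refine Ideal.isMaximal_def.2 ⟨fun h => ?_, fun I hI => ?_⟩
  -- `a f = 1` is only a one-sided inverse; additivity of degrees makes `f` a nonzero constant,
  -- hence a unit.
  · obtain ⟨a, ha⟩ := Ideal.mem_span_singleton'.1 (h ▸ Submodule.mem_top : (1 : SkewPolynomial K) ∈ _)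
    have hf0 := hf.ne_zero
    have ha0 : a ≠ 0 := by
      rintro rfl
      simp at ha
    have hd := (natDegree_mul ha0 hf0).2
    have h1 : (1 : SkewPolynomial K).natDegree = 0 :=
      natDegree_eq_of_coeff (by simp) fun n hn => by rw [coeff_one, if_neg hn.ne]
    rw [ha, h1] at hd
    have hfC : f = C (f.coeff 0) := by
      ext n
      cases n with
      | zero => simp
      | succ n => rw [coeff_eq_zero_of_natDegree_lt (by omega), coeff_C_succ]
    refine hf.not_isUnit (hfC ▸ isUnit_C fun h0 => hf0 ?_)
    rw [hfC, h0, C_0]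
  · obtain ⟨h, rfl⟩ := exists_eq_span_singleton I
    have hfI := hI.le (Ideal.mem_span_singleton_self f)
    obtain ⟨a, ha⟩ := Ideal.mem_span_singleton'.1 hfI
    by_contra htop
    refine hI.not_ge ((Ideal.span_singleton_le_iff_mem _).2 (key a h ha fun hu => htop ?_))
    exact Ideal.eq_top_of_isUnit_mem _ (Ideal.mem_span_singleton_self h) hu

theorem exists_mul_add_mul_eq_one {f u : SkewPolynomial K} (hf : Irreducible f)
    (hu : ¬ RightDvd f u) : ∃ a b, a * u + b * f = 1 := by
  obtain ⟨a, m, hm, h⟩ := (span_singleton_isMaximal hf).exists_inv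
    (mt rightDvd_iff_mem_span.2 hu)
  obtain ⟨b, rfl⟩ := Ideal.mem_span_singleton'.1 hm
  exact ⟨a, b, h⟩

theorem RightDvd.mul_left {f h : SkewPolynomial K} (H : RightDvd f h) (a : SkewPolynomial K) :
    RightDvd f (a * h) := by
  obtain ⟨b, rfl⟩ := H
  exact ⟨a * b, (mul_assoc _ _ _).symm⟩

theorem RightDvd.add {f h k : SkewPolynomial K} (H : RightDvd f h) (H' : RightDvd f k) :
    RightDvd f (h + k) := by
  obtain ⟨b, rfl⟩ := H
  obtain ⟨c, rfl⟩ := H'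
  exact ⟨b + c, (add_mul _ _ _).symm⟩

theorem RightDvd.sub {f h k : SkewPolynomial K} (H : RightDvd f h) (H' : RightDvd f k) :
    RightDvd f (h - k) := by
  obtain ⟨b, rfl⟩ := H
  obtain ⟨c, rfl⟩ := H'
  exact ⟨b - c, (sub_mul _ _ _).symm⟩

theorem not_rightDvd_one {f : SkewPolynomial K} (hf : Irreducible f) : ¬ RightDvd f 1 := fun h =>
  (span_singleton_isMaximal hf).ne_top ((Ideal.eq_top_iff_one _).2 (rightDvd_iff_mem_span.1 h))

/-- If `g u` is divisible by `f` and `u` is not, then `{x | f ∣ x u}` is the left ideal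
generated by `g`. -/
theorem rightDvd_mul_iff {f g u : SkewPolynomial K} (hg : Irreducible g) (hu : ¬ RightDvd f u)
    (h : RightDvd f (g * u)) {x : SkewPolynomial K} : RightDvd f (x * u) ↔ RightDvd g x := by
  refine ⟨fun hx => ?_, ?_⟩
  · by_contra hgx
    obtain ⟨a, b, hab⟩ := exists_mul_add_mul_eq_one hg hgx
    refine hu ?_
    rw [← one_mul u, ← hab, add_mul, mul_assoc, mul_assoc]
    exact (hx.mul_left a).add (h.mul_left b)
  · rintro ⟨a, rfl⟩
    rw [mul_assoc]
    exact h.mul_left a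

/-- Centrality turns `u z` into `z u`, which moves divisibility of `z` by `f` to `g` through
`rightDvd_mul_iff`. Backwards, multiply `a u + b f = 1` by `z` and move `z` past `u` and `f`. -/
theorem rightDvd_iff_of_mem_center {f g u : SkewPolynomial K} (hf : Irreducible f)
    (hg : Irreducible g) (hu : ¬ RightDvd f u) (h : RightDvd f (g * u)) {z : SkewPolynomial K}
    (hz : z ∈ Subring.center (SkewPolynomial K)) : RightDvd f z ↔ RightDvd g z := by
  have hz' := Subring.mem_center_iff.1 hz
  refine ⟨fun hfz => (rightDvd_mul_iff hg hu h).1 ?_, fun hgz => ?_⟩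
  · rw [← hz']
    exact hfz.mul_left u
  · obtain ⟨a, b, hab⟩ := exists_mul_add_mul_eq_one hf hu
    rw [← one_mul z, ← hab, add_mul, mul_assoc, mul_assoc, hz' u, hz' f, ← mul_assoc b]
    exact (((rightDvd_mul_iff hg hu h).2 hgz).mul_left a).add ⟨b * z, rfl⟩

theorem mzlm_eq_of_similar [Finite K] {f g : SkewPolynomial K} (hf : Irreducible f)
    (hg : Irreducible g) (h : Similar f g) : mzlm f = mzlm g := by
  obtain ⟨-, u, hu0, hud, hu⟩ := h
  have hfu : ¬ RightDvd f u := fun h => hu0 (eq_zero_of_rightDvd_of_degree_lt h hud)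
  have key : ∀ m, IsMonicCentralLeftMultiple f m ↔ IsMonicCentralLeftMultiple g m := fun m =>
    and_congr_right fun _ => and_congr_right fun hz => rightDvd_iff_of_mem_center hf hg hfu hu hz
  refine (isMzlm_mzlm hf.ne_zero).unique ?_
  have := isMzlm_mzlm hg.ne_zero
  exact ⟨(key _).2 this.1, fun m' hm' => this.2 m' ((key _).1 hm')⟩

/-- A nonzero map between the quotients by `g` and `f` bounds the degree of `g`. -/
theorem natDegree_le_of_rightDvd_mul [Finite K] {f g u : SkewPolynomial K} (hf : f ≠ 0)
    (hg : Irreducible g) (hu : ¬ RightDvd f u) (h : RightDvd f (g * u)) :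
    g.natDegree ≤ f.natDegree := by
  choose a r har hr using fun x : SkewPolynomial K => exists_right_division hf (x * u)
  -- Right multiplication by `u` followed by reduction modulo `f` embeds the remainders modulo `g`
  -- into those modulo `f`; these sets have `|K|` to the power of the respective degree as
  -- cardinality.
  have hinj : Function.Injective
      (fun x : {x : SkewPolynomial K // x.degree < (g.natDegree : WithBot ℕ)} =>
        (⟨r x, degree_eq_natDegree hf ▸ hr x⟩ :
          {x : SkewPolynomial K // x.degree < (f.natDegree : WithBot ℕ)})) := by
    intro x y hxy
    have hxy' : r x = r y := congrArg Subtype.val hxy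
    have h1 : RightDvd g (x.1 - y.1) := (rightDvd_mul_iff hg hu h).1
      ⟨a x - a y, by rw [sub_mul, har x, har y, hxy', sub_mul]; abel⟩
    refine Subtype.ext (sub_eq_zero.1 (eq_zero_of_rightDvd_of_degree_lt h1 ?_))
    rw [degree_eq_natDegree hg.ne_zero, degree_lt_iff_coeff]
    intro n hn
    rw [coeff_sub, degree_lt_iff_coeff.1 x.2 n hn, degree_lt_iff_coeff.1 y.2 n hn, sub_zero]
  have : Finite {x : SkewPolynomial K // x.degree < (f.natDegree : WithBot ℕ)} :=
    Finite.of_equiv _ (degreeLTEquiv f.natDegree).symm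
  have hc := Nat.card_le_card_of_injective _ hinj
  rw [Nat.card_congr (degreeLTEquiv _), Nat.card_congr (degreeLTEquiv _), Nat.card_fun,
    Nat.card_fun, Nat.card_fin, Nat.card_fin] at hc
  exact (Nat.pow_le_pow_iff_right Finite.one_lt_card).1 hc

end Ideals
end SkewPolynomial

namespace SkewPolynomial

/-! ### The role of `X`, and the annihilator of the quotient by `f` -/

section Annihilator

variable {K : Type*} [Field K] [MulSemiringAction (Multiplicative ℕ) K]

theorem coeff_mul_X_zero (v : SkewPolynomial K) : (v * X).coeff 0 = 0 := by
  induction v using SkewPolynomial.induction with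
  | h0 => simp
  | ha n a q _ _ hq => rw [add_mul, coeff_add, hq, monomial_mul_X, coeff_monomial_succ, add_zero]

theorem coeff_X_mul_zero (v : SkewPolynomial K) : (X * v).coeff 0 = 0 := by
  rw [X_mul, coeff_mul_X_zero]

theorem coeff_mul_X_succ (v : SkewPolynomial K) (n : ℕ) : (v * X).coeff (n + 1) = v.coeff n := by
  rw [← monomial_one_one_eq_X, coeff_mul_monomial_add, iterate_map_one, mul_one]

theorem coeff_X_mul_succ (v : SkewPolynomial K) (n : ℕ) :
    (X * v).coeff (n + 1) = φ (v.coeff n) := by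
  rw [← monomial_one_one_eq_X, coeff_monomial_mul_add, one_mul, Function.iterate_one]

theorem exists_eq_mul_X_add_C (p : SkewPolynomial K) : ∃ v, p = v * X + C (p.coeff 0) := by
  obtain ⟨v, r, h, hr⟩ := exists_right_division X_ne_zero p
  have hX : (X : SkewPolynomial K).degree = ((1 : ℕ) : WithBot ℕ) := by
    rw [degree_eq_natDegree X_ne_zero, natDegree_eq_of_coeff (N := 1) (by simp)
      fun n hn => coeff_X_of_ne_one hn.ne']
  rw [hX, degree_lt_iff_coeff] at hr
  have hr0 : r = C (r.coeff 0) := by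
    ext n
    cases n with
    | zero => simp
    | succ n => rw [hr _ (by omega), coeff_C_succ]
  refine ⟨v, ?_⟩
  have h0 : p.coeff 0 = r.coeff 0 := by rw [h, coeff_add, coeff_mul_X_zero, zero_add]
  rw [h0, ← hr0]
  exact h

theorem not_isUnit_X : ¬ IsUnit (X : SkewPolynomial K) := by
  rintro ⟨u, hu⟩
  have := coeff_mul_X_zero (↑u⁻¹ : SkewPolynomial K)
  rw [← hu, u.inv_mul, coeff_one_zero] at this
  exact one_ne_zero this

/-- Modulo `X`, `f` is its constant coefficient; if that were nonzero, `f` would divide a unit. -/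
theorem exists_unit_mul_X {f : SkewPolynomial K} (hf : Irreducible f) (h : RightDvd f X) :
    ∃ b : (SkewPolynomial K)ˣ, f = (b : SkewPolynomial K) * X := by
  obtain ⟨v, hv⟩ := exists_eq_mul_X_add_C f
  by_cases h0 : f.coeff 0 = 0
  · rw [h0, C_0, add_zero] at hv
    obtain ⟨b, rfl⟩ := (hf.isUnit_or_isUnit hv).resolve_right not_isUnit_X
    exact ⟨b, hv⟩
  · have h1 : RightDvd f (C (f.coeff 0)) := by
      rw [show C (f.coeff 0) = f - v * X from eq_sub_of_add_eq' hv.symm]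
      exact RightDvd.sub ⟨1, (one_mul f).symm⟩ (h.mul_left v)
    obtain ⟨b, hb⟩ := isUnit_C h0
    refine absurd (h1.mul_left ↑b⁻¹) ?_
    rw [← hb, b.inv_mul]
    exact not_rightDvd_one hf

/-- Finiteness makes `φ` surjective, so coefficients can be pulled through `X` from left to right.
-/
theorem exists_mul_X_eq_X_mul [Finite K] (x : SkewPolynomial K) : ∃ y, x * X = X * y := by
  induction x using SkewPolynomial.induction with
  | h0 => exact ⟨0, by simp⟩
  | ha n a q _ _ hq =>
    obtain ⟨y, hy⟩ := hq
    obtain ⟨b, hb⟩ := Finite.injective_iff_surjective.1 (φ : K →+* K).injective a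
    exact ⟨monomial n b + y, by rw [add_mul, mul_add, hy, monomial_mul_X, X_mul_monomial, hb]⟩

/-- `X` acts surjectively on the quotient by `f`, unless it acts as zero. -/
theorem exists_rightDvd_sub_X_mul [Finite K] {f : SkewPolynomial K} (hf : Irreducible f)
    (hX : ¬ RightDvd f X) (y : SkewPolynomial K) : ∃ x, RightDvd f (y - X * x) := by
  obtain ⟨a, b, hab⟩ := exists_mul_add_mul_eq_one hf hX
  obtain ⟨x, hx⟩ := exists_mul_X_eq_X_mul (y * a)
  refine ⟨x, y * b, ?_⟩
  rw [← hx, sub_eq_iff_eq_add', mul_assoc, mul_assoc, ← mul_add, hab, mul_one]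

/-- The annihilator of the quotient by the left ideal generated by `f`. -/
def quotientAnnihilator (f : SkewPolynomial K) : Ideal (SkewPolynomial K) where
  carrier := {r | ∀ x, RightDvd f (r * x)}
  add_mem' ha hb x := by
    rw [add_mul]
    exact (ha x).add (hb x)
  zero_mem' x := ⟨0, by simp⟩
  smul_mem' c r hr x := by
    rw [smul_eq_mul, mul_assoc]
    exact (hr x).mul_left c

theorem mem_quotientAnnihilator {f r : SkewPolynomial K} :
    r ∈ quotientAnnihilator f ↔ ∀ x, RightDvd f (r * x) := Iff.rfl

theorem mul_mem_quotientAnnihilator {f r : SkewPolynomial K} (hr : r ∈ quotientAnnihilator f)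
    (c : SkewPolynomial K) : r * c ∈ quotientAnnihilator f := fun x => by
  rw [mul_assoc]
  exact hr _

theorem rightDvd_of_mem_quotientAnnihilator {f r : SkewPolynomial K}
    (hr : r ∈ quotientAnnihilator f) : RightDvd f r := by
  simpa using hr 1

/-- `X` acts surjectively on the quotient, so anything killing its image kills everything. -/
theorem mem_quotientAnnihilator_of_mul_X [Finite K] {f v : SkewPolynomial K} (hf : Irreducible f)
    (hX : ¬ RightDvd f X) (hv : v * X ∈ quotientAnnihilator f) : v ∈ quotientAnnihilator f := by
  intro y
  obtain ⟨x, hx⟩ := exists_rightDvd_sub_X_mul hf hX y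
  rw [show v * y = v * X * x + v * (y - X * x) by rw [mul_sub, mul_assoc]; abel]
  exact (hv x).add (hx.mul_left v)

theorem mem_quotientAnnihilator_of_mem_center {f z : SkewPolynomial K}
    (hz : z ∈ Subring.center (SkewPolynomial K)) (h : RightDvd f z) :
    z ∈ quotientAnnihilator f := fun x => by
  rw [← Subring.mem_center_iff.1 hz]
  exact h.mul_left x

/-- A monic element of minimal degree of a nonzero left ideal. -/
theorem exists_monic_minimal {I : Ideal (SkewPolynomial K)} {m : SkewPolynomial K} (hm : m ∈ I)
    (hm0 : m ≠ 0) : ∃ w ∈ I, w.Monic ∧ ∀ v ∈ I, (∀ n, w.natDegree ≤ n → v.coeff n = 0) → v = 0 := by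
  obtain ⟨h, ⟨hI, h0⟩, hmin⟩ := (InvImage.wf (fun p : SkewPolynomial K => p.degree)
    wellFounded_lt).has_min {x | x ∈ I ∧ x ≠ 0} ⟨m, hm, hm0⟩
  have hc := coeff_natDegree_ne_zero h0
  have hnd : (C (h.coeff h.natDegree)⁻¹ * h).natDegree = h.natDegree :=
    natDegree_eq_of_coeff (by rw [coeff_C_mul', inv_mul_cancel₀ hc]; exact one_ne_zero)
      fun n hn => by rw [coeff_C_mul', coeff_eq_zero_of_natDegree_lt hn, mul_zero]
  refine ⟨C (h.coeff h.natDegree)⁻¹ * h, I.mul_mem_left _ hI, ?_, fun v hv hvn => ?_⟩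
  · rw [Monic, hnd, coeff_C_mul', inv_mul_cancel₀ hc]
  · by_contra hv0
    refine hmin v ⟨hv, hv0⟩ ?_
    change v.degree < h.degree
    rw [degree_eq_natDegree h0, degree_lt_iff_coeff, ← hnd]
    exact hvn

/-- If `f` does not divide `X`, the annihilator of the quotient by `f` is generated by the minimal
central left multiple of `f`, whose constant coefficient is nonzero. -/
theorem quotientAnnihilator_eq_span_mzlm [Finite K] {f : SkewPolynomial K} (hf : Irreducible f)
    (hX : ¬ RightDvd f X) :
    quotientAnnihilator f = Ideal.span {mzlm f} ∧ (mzlm f).coeff 0 ≠ 0 := by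
  have hm := isMzlm_mzlm hf.ne_zero
  obtain ⟨w, hw, hwm, hmin⟩ := exists_monic_minimal
    (mem_quotientAnnihilator_of_mem_center hm.1.2.1 hm.1.2.2) hm.1.1.ne_zero
  -- Otherwise `w = v X`, and `X` cancels to leave an annihilating `v` of smaller degree.
  have hw0 : w.coeff 0 ≠ 0 := by
    intro h0
    obtain ⟨v, hv⟩ := exists_eq_mul_X_add_C w
    rw [h0, C_0, add_zero] at hv
    have hv0 := hmin v (mem_quotientAnnihilator_of_mul_X hf hX (hv ▸ hw)) fun n hn => by
      rw [← coeff_mul_X_succ, ← hv, coeff_eq_zero_of_natDegree_lt (by omega)]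
    exact hwm.ne_zero (by rw [hv, hv0, zero_mul])
  -- The annihilator is two-sided, and the terms in the degree of `w` cancel in the difference, so
  -- minimality forces it to vanish.
  have hCσ : ∀ a, w * C a = C (φ^[w.natDegree] a) * w := fun a => by
    refine sub_eq_zero.1 (hmin _ (Ideal.sub_mem _ (mul_mem_quotientAnnihilator hw _)
      (Ideal.mul_mem_left _ _ hw)) fun n hn => ?_)
    have h1 : (w * C a).coeff n = w.coeff n * φ^[n] a := by
      simpa using coeff_mul_monomial_add 0 n a w
    rw [coeff_sub, coeff_C_mul', h1]
    rcases eq_or_lt_of_le hn with rfl | hn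
    · rw [mul_comm, sub_self]
    · rw [coeff_eq_zero_of_natDegree_lt hn, zero_mul, mul_zero, sub_zero]
  -- Compare constant coefficients, where no twist occurs, and cancel `w.coeff 0`.
  have hσ : ∀ a : K, φ^[w.natDegree] a = a := fun a => by
    have h1 : (w * C a).coeff 0 = w.coeff 0 * a := by
      simpa using coeff_mul_monomial_add 0 0 a w
    rw [hCσ, coeff_C_mul', mul_comm] at h1
    exact mul_left_cancel₀ hw0 h1
  have hC : ∀ a, w * C a = C a * w := fun a => by rw [hCσ, hσ]
  -- The commutator may still have the degree of `w`, too large for minimality. Its constant term is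
  -- zero, so one factor `X` cancels and brings the degree below.
  have hXw : w * X = X * w := by
    obtain ⟨v, hv⟩ := exists_eq_mul_X_add_C (w * X - X * w)
    rw [coeff_sub, coeff_mul_X_zero, coeff_X_mul_zero, sub_zero, C_0, add_zero] at hv
    have hvI : v * X ∈ quotientAnnihilator f := hv ▸
      Ideal.sub_mem _ (mul_mem_quotientAnnihilator hw _) (Ideal.mul_mem_left _ _ hw)
    have hv0 := hmin v (mem_quotientAnnihilator_of_mul_X hf hX hvI) fun n hn => by
      rw [← coeff_mul_X_succ, ← hv, coeff_sub, coeff_mul_X_succ, coeff_X_mul_succ]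
      rcases eq_or_lt_of_le hn with rfl | hn
      · have : w.coeff w.natDegree = 1 := hwm
        rw [this, map_one, sub_self]
      · rw [coeff_eq_zero_of_natDegree_lt hn, map_zero, sub_self]
    rwa [hv0, zero_mul, sub_eq_zero] at hv
  have hwz : w ∈ Subring.center (SkewPolynomial K) := mem_center_of_commute fun n a => by
    rw [← C_mul_X_pow_eq_monomial, mul_assoc, ← (show Commute w X from hXw).pow_right n,
      ← mul_assoc, ← hC, mul_assoc]
  have hwM : IsMzlm f w := by
    refine ⟨⟨hwm, hwz, rightDvd_of_mem_quotientAnnihilator hw⟩, fun m' hm' => ?_⟩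
    by_contra hlt
    rw [not_le, degree_eq_natDegree hwm.ne_zero, degree_lt_iff_coeff] at hlt
    exact hm'.1.ne_zero
      (hmin m' (mem_quotientAnnihilator_of_mem_center hm'.2.1 hm'.2.2) hlt)
  rw [hm.unique hwM]
  refine ⟨le_antisymm (fun x hx => ?_) ((Ideal.span_singleton_le_iff_mem _).2 hw), hw0⟩
  obtain ⟨a, r, rfl, hr⟩ := exists_right_division hwm.ne_zero x
  have hrI : r ∈ quotientAnnihilator f :=
    (Submodule.add_mem_iff_right _ (Ideal.mul_mem_left _ a hw)).1 hx
  rw [degree_eq_natDegree hwm.ne_zero, degree_lt_iff_coeff] at hr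
  rw [hmin r hrI hr, add_zero]
  exact Ideal.mem_span_singleton'.2 ⟨a, rfl⟩

theorem coeff_zero_mzlm_eq_zero_iff [Finite K] {f : SkewPolynomial K} (hf : Irreducible f) :
    (mzlm f).coeff 0 = 0 ↔ RightDvd f X := by
  refine ⟨fun h => ?_, fun h => ?_⟩
  · by_contra hX
    exact (quotientAnnihilator_eq_span_mzlm hf hX).2 h
  · obtain ⟨b, hb⟩ := exists_unit_mul_X hf h
    obtain ⟨a, ha⟩ := (isMzlm_mzlm hf.ne_zero).1.2.2
    rw [ha, hb, ← mul_assoc, coeff_mul_X_zero]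

end Annihilator

/-! ### From equal minimal central multiples to similarity -/

section Similar

variable {K : Type*} [Field K] [Finite K] [MulSemiringAction (Multiplicative ℕ) K]

theorem finite_quotient_span {f : SkewPolynomial K} (hf : f ≠ 0) :
    Finite (SkewPolynomial K ⧸ Ideal.span ({f} : Set (SkewPolynomial K))) := by
  have : Finite {x : SkewPolynomial K // x.degree < (f.natDegree : WithBot ℕ)} :=
    Finite.of_equiv _ (degreeLTEquiv f.natDegree).symm
  refine Finite.of_surjective (fun x : {x : SkewPolynomial K //
    x.degree < (f.natDegree : WithBot ℕ)} => Submodule.Quotient.mk x.1) fun y => ?_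
  obtain ⟨y, rfl⟩ := Submodule.Quotient.mk_surjective _ y
  obtain ⟨a, r, rfl, hr⟩ := exists_right_division hf y
  refine ⟨⟨r, degree_eq_natDegree hf ▸ hr⟩, ?_⟩
  rw [eq_comm, Submodule.Quotient.eq, add_sub_cancel_right]
  exact Ideal.mem_span_singleton'.2 ⟨a, rfl⟩

/-- If the annihilator of the quotient by `f` lies in the left ideal generated by `g`, then `g`
does not act injectively on this finite quotient. -/
theorem exists_rightDvd_mul {f g : SkewPolynomial K} (hf : f ≠ 0) (hg : Irreducible g)
    (h : ∀ r ∈ quotientAnnihilator f, RightDvd g r) :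
    ∃ u, ¬ RightDvd f u ∧ RightDvd f (g * u) := by
  by_contra! H
  have := finite_quotient_span hf
  have hinj : Function.Injective (fun x : SkewPolynomial K ⧸ Ideal.span {f} => g • x) := by
    intro x y hxy
    obtain ⟨x, rfl⟩ := Submodule.Quotient.mk_surjective _ x
    obtain ⟨y, rfl⟩ := Submodule.Quotient.mk_surjective _ y
    rw [Submodule.Quotient.eq, ← rightDvd_iff_mem_span]
    by_contra hn
    refine H _ hn ?_
    rw [rightDvd_iff_mem_span, mul_sub]
    exact (Submodule.Quotient.eq _).1 hxy
  -- An injective self-map of a finite set has finite order, so `g ^ (k + 1)` acts as the identity,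
  -- where `k + 1` is that order.
  let s : Equiv.Perm (SkewPolynomial K ⧸ Ideal.span {f}) :=
    Equiv.ofBijective _ (Finite.injective_iff_bijective.1 hinj)
  have hs : ∀ k x, (s ^ k) x = g ^ k • x := fun k x => by
    rw [← Equiv.Perm.iterate_eq_pow]
    exact smul_iterate_apply g k x
  obtain ⟨k, hk⟩ := Nat.exists_eq_succ_of_ne_zero (orderOf_pos s).ne'
  have hmem : g ^ (k + 1) - 1 ∈ quotientAnnihilator f := fun x => by
    rw [rightDvd_iff_mem_span, sub_mul, one_mul]
    refine (Submodule.Quotient.eq _).1 ?_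
    have h1 := hs (orderOf s) (Submodule.Quotient.mk x)
    rw [pow_orderOf_eq_one, hk] at h1
    exact h1.symm
  refine not_rightDvd_one hg ?_
  rw [show (1 : SkewPolynomial K) = g ^ (k + 1) - (g ^ (k + 1) - 1) by abel]
  exact RightDvd.sub ⟨g ^ k, pow_succ g k⟩ (h _ hmem)

/-- Nonzero maps in both directions force equal degrees; replacing `u` by its remainder modulo `f`
meets the degree bound in `Similar`. -/
theorem similar_of_exists {f g u v : SkewPolynomial K} (hf : Irreducible f) (hg : Irreducible g)
    (hu : ¬ RightDvd f u) (hgu : RightDvd f (g * u)) (hv : ¬ RightDvd g v)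
    (hfv : RightDvd g (f * v)) : Similar f g := by
  refine ⟨?_, ?_⟩
  · rw [degree_eq_natDegree hf.ne_zero, degree_eq_natDegree hg.ne_zero,
      le_antisymm (natDegree_le_of_rightDvd_mul hg.ne_zero hf hv hfv)
        (natDegree_le_of_rightDvd_mul hf.ne_zero hg hu hgu)]
  · obtain ⟨a, r, rfl, hr⟩ := exists_right_division hf.ne_zero u
    have ha : RightDvd f (a * f) := ⟨a, rfl⟩
    refine ⟨r, ?_, hr, ?_⟩
    · rintro rfl
      exact hu (by rwa [add_zero])
    · rw [show g * r = g * (a * f + r) - g * (a * f) by rw [mul_add]; abel]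
      exact hgu.sub (ha.mul_left g)

theorem exists_rightDvd_mul_of_mzlm_eq {f g : SkewPolynomial K} (hf : Irreducible f)
    (hg : Irreducible g) (h : mzlm f = mzlm g) : ∃ u, ¬ RightDvd f u ∧ RightDvd f (g * u) := by
  by_cases hX : RightDvd f X
  · have hX' : RightDvd g X := by
      rwa [← coeff_zero_mzlm_eq_zero_iff hg, ← h, coeff_zero_mzlm_eq_zero_iff hf]
    obtain ⟨b, hb⟩ := exists_unit_mul_X hg hX'
    exact ⟨1, not_rightDvd_one hf, by rw [mul_one, hb]; exact hX.mul_left _⟩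
  · refine exists_rightDvd_mul hf.ne_zero hg fun r hr => ?_
    rw [(quotientAnnihilator_eq_span_mzlm hf hX).1, h] at hr
    obtain ⟨a, rfl⟩ := Ideal.mem_span_singleton'.1 hr
    exact (isMzlm_mzlm hg.ne_zero).1.2.2.mul_left a

end Similar

end SkewPolynomial

theorem mainTheorem4 {K : Type*} [Field K] [Finite K]
    [MulSemiringAction (Multiplicative ℕ) K]
    (σ : K ≃+* K) (hσ : ∀ a : K, SkewPolynomial.φ a = σ a)
    (f g : SkewPolynomial K) (hf : Irreducible f) (hg : Irreducible g) :
    SkewPolynomial.Similar f g ↔ SkewPolynomial.mzlm f = SkewPolynomial.mzlm g := by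
  refine ⟨SkewPolynomial.mzlm_eq_of_similar hf hg, fun h => ?_⟩
  obtain ⟨u, hu, hgu⟩ := SkewPolynomial.exists_rightDvd_mul_of_mzlm_eq hf hg h
  obtain ⟨v, hv, hfv⟩ := SkewPolynomial.exists_rightDvd_mul_of_mzlm_eq hg hf h.symm
  exact SkewPolynomial.similar_of_exists hf hg hu hgu hv hfv
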